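/- A weighted species $\mathcal{A}^{\alpha}$ is a species of combinatorial structures (a functorial assignment of a finite set $\mathcal{A}[U]$ to every finite set $U$) together with weights $\alpha(A)\in[0,\infty)$ of the structures $A$ that are invariant under relabelling. Write $|A|=|U|$ for $A\in\mathcal{A}[U]$, $\mathcal{A}[n]=\mathcal{A}[\{1,\dots,n\}]$, and $\mathcal{A}^{\alpha}(z)=\sum_{n\ge 0}\frac{z^n}{n!}\sum_{A\in\mathcal{A}[n]}\alpha(A)$. For $d\ge 1$, a power series $g(z)=\sum_{n\ge0} g_nz^n$ with non-negative coefficients and radius of convergence $\rho\in(0,\infty)$ belongs to $\mathscr{S}_d$ if $g_n=0$ whenever $d\nmid n$, $g(\rho)<\infty$, and, as $n\to\infty$ with $n\equiv 0 \bmod d$, $$\frac{g_n}{g_{n+d}}\to\rho^d,\qquad \frac1{g_n}\sum_{i+j=n}g_ig_j\to 2g(\rho).$$ Let $\mathcal{F}^\omega$ and $\mathcal{G}^\nu$ be weighted species with $\mathcal{G}[\emptyset]=\emptyset$ and $[z^k]\mathcal{F}^\omega(z)>0$ for at least one $k\ge 1$. The composition $\mathcal{F}\circ\mathcal{G}$ assigns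 to $U$ the set of all $(F,(G_Q)_{Q\in\pi})$ where $\pi$ is a partition of $U$ into non-empty classes, $F\in\mathcal{F}[\pi]$ and $G_Q\in\mathcal{G}[Q]$, with weight $\mu=\omega(F)\prod_{Q\in\pi}\nu(G_Q)$; its number of components is $c(F,(G_Q)_{Q\in\pi})=|\pi|$. The derived species is $\mathcal{F}'[U]=\mathcal{F}[U\cup\{*\}]$, with the same weights, where $*\notin U$ is a placeholder; $\mathcal{F}'\circ\mathcal{G}$, its weight (again denoted $\mu$) and $c$ on it are defined likewise, so that the placeholder is not counted as a component. **Proposition.** Suppose that $\mathcal{G}^\nu(z)$ belongs to $\mathscr{S}_d$ with radius of convergence $\rho$, and that $\mathcal{F}^\omega(z)$ has radius of convergence strictly larger than $\mathcal{G}^\nu(\rho)$. For $n$ such that $(\mathcal{F}\circ\mathcal{G})[n]$ has positive total weight, let $\mathsf{S}_n$ be a random element of $(\mathcal{F}\circ\mathcal{G})[n]$ drawn with probability proportional to its weight $\mu$. Let $\mathsf{R}$ be a random element of $\bigcup_{m\ge0}(\mathcal{F}'\circ\mathcal{G})[m]$ with the Boltzmann distribution $$\mathbb{P}(\mathsf{R}=R)=\frac{\mu(R)\,\rho^{|R|}/|R|!}{\big((\mathcal{F}')^\omega\circ\mathcal{G}^\nu\big)(\rho)}.$$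 Then $\mathsf{R}$ is well defined, $\mathsf{S}_n$ is well defined for all sufficiently large $n\equiv0\bmod d$, and, as $n\to\infty$ with $n\equiv 0\bmod d$, $$\sup_{E\subseteq\mathbb{N}_0}\big|\mathbb{P}(c(\mathsf{S}_n)\in E)-\mathbb{P}(1+c(\mathsf{R})\in E)\big|\to0,$$ and for every integer $k\ge 0$ the moment $\mathbb{E}[(1+c(\mathsf{R}))^k]$ is finite and $$\mathbb{E}[c(\mathsf{S}_n)^k]\to\mathbb{E}[(1+c(\mathsf{R}))^k].$$ -/

import Mathlib

open scoped NNReal ENNReal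
open Filter Topology MeasureTheory

universe u v

noncomputable section

/-! ## Weighted combinatorial species -/

/-- A combinatorial species with non-negative weights: every finite label set `U` gets a finite set
`obj U` of structures with weights in `[0, ∞)`, and bijections of label sets act functorially and
preserve the weights (functoriality makes each `map σ` a bijection). -/
structure WeightedSpecies where
  obj : (U : Type) → [Finite U] → Type u
  finite_obj : ∀ (U : Type) [Finite U], Finite (obj U)
  map : {U V : Type} → [Finite U] → [Finite V] → (U ≃ V) → obj U → obj V
  map_refl : ∀ {U : Type} [Finite U] (x : obj U), map (Equiv.refl U) x = x
  map_trans : ∀ {U V W : Type} [Finite U] [Finite V] [Finite W] (σ : U ≃ V) (τ : V ≃ W)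
    (x : obj U), map (σ.trans τ) x = map τ (map σ x)
  weight : {U : Type} → [Finite U] → obj U → ℝ≥0
  weight_map : ∀ {U V : Type} [Finite U] [Finite V] (σ : U ≃ V) (x : obj U),
    weight (map σ x) = weight x

namespace WeightedSpecies

instance (A : WeightedSpecies.{u}) (U : Type) [Finite U] : Finite (A.obj U) := A.finite_obj U

/-- Sets of structures carry the discrete σ-algebra. -/
instance (A : WeightedSpecies.{u}) (U : Type) [Finite U] : MeasurableSpace (A.obj U) := ⊤

/-- The exponential generating series: the coefficient of `z ^ n` is the total weight of all
structures on an `n`-element label set, divided by `n!`. -/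
def egf (A : WeightedSpecies.{u}) : PowerSeries ℝ :=
  PowerSeries.mk fun n => (∑ᶠ x : A.obj (Fin n), (A.weight x : ℝ)) / (n.factorial : ℝ)

/-- The set of all structures on the label sets with `0, 1, 2, …` elements. -/
def Universe (A : WeightedSpecies.{u}) : Type u := Σ n : ℕ, A.obj (Fin n)

instance (A : WeightedSpecies.{u}) : MeasurableSpace A.Universe := ⊤

/-- The derived species: structures on `U` together with one placeholder atom `none`. -/
def derived (A : WeightedSpecies.{u}) : WeightedSpecies.{u} where
  obj U _ := A.obj (Option U)
  finite_obj _ _ := inferInstance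
  map σ := A.map σ.optionCongr
  map_refl x := by rw [Equiv.optionCongr_refl]; exact A.map_refl x
  map_trans σ τ x := by rw [← A.map_trans, Equiv.optionCongr_trans]
  weight x := A.weight x
  weight_map σ x := A.weight_map _ x

end WeightedSpecies

/-! ## Composite structures -/

/-- A composite structure on `U`: a partition of `U` into non-empty classes, an `F`-structure on the
set of classes, and a `G`-structure on each class. -/
@[ext]
structure CompositeStructure (F : WeightedSpecies.{u}) (G : WeightedSpecies.{v})
    (U : Type) [Finite U] where
  parts : Set (Set U)
  isPartition : Setoid.IsPartition parts
  outer : F.obj parts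
  inner : (Q : parts) → G.obj (Q : Set U)

namespace CompositeStructure

variable {F : WeightedSpecies.{u}} {G : WeightedSpecies.{v}} {U V : Type}

instance [Finite U] : Finite (CompositeStructure F G U) := by
  let f : CompositeStructure F G U →
      (Σ p : Set (Set U), F.obj p × ((Q : p) → G.obj (Q : Set U))) :=
    fun s => ⟨s.parts, s.outer, s.inner⟩
  refine Finite.of_injective f ?_
  rintro ⟨p, hp, x, g⟩ ⟨p', hp', x', g'⟩ h
  simp only [f, Sigma.mk.injEq] at h
  obtain ⟨rfl, h⟩ := h
  simp only [heq_eq_eq, Prod.mk.injEq] at h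
  obtain ⟨rfl, rfl⟩ := h
  rfl

/-- The number of components, that is, of partition classes. -/
def numComponents [Finite U] (s : CompositeStructure F G U) : ℕ := Nat.card s.parts

/-- The image of a partition under a bijection, `{σ(Q) | Q ∈ p}`. -/
def mapParts (σ : U ≃ V) (p : Set (Set U)) : Set (Set V) := {P | σ ⁻¹' P ∈ p}

theorem mapParts_eq_image (σ : U ≃ V) (p : Set (Set U)) :
    mapParts σ p = (fun Q => σ '' Q) '' p := by
  ext P
  constructor
  · intro h
    exact ⟨σ ⁻¹' P, h, Set.image_preimage_eq P σ.surjective⟩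
  · rintro ⟨Q, hQ, rfl⟩
    change σ ⁻¹' (σ '' Q) ∈ p
    rwa [Set.preimage_image_eq Q σ.injective]

theorem isPartition_mapParts (σ : U ≃ V) {p : Set (Set U)} (hp : Setoid.IsPartition p) :
    Setoid.IsPartition (mapParts σ p) := by
  refine ⟨fun h => hp.1 h, fun y => ?_⟩
  obtain ⟨Q, ⟨hQ, hyQ⟩, huniq⟩ := hp.2 (σ.symm y)
  refine ⟨σ '' Q, ⟨?_, ⟨σ.symm y, hyQ, by simp⟩⟩, ?_⟩
  · change σ ⁻¹' (σ '' Q) ∈ p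
    rwa [Set.preimage_image_eq Q σ.injective]
  · rintro P ⟨hP, hyP⟩
    rw [← huniq (σ ⁻¹' P) ⟨hP, by simpa using hyP⟩, Set.image_preimage_eq P σ.surjective]

/-- The bijection `Q ↦ σ(Q)` between the classes of a partition and those of its image. -/
def partsEquiv (σ : U ≃ V) (p : Set (Set U)) : p ≃ mapParts σ p where
  toFun Q := ⟨σ '' Q, by
    change σ ⁻¹' (σ '' (Q : Set U)) ∈ p
    rw [Set.preimage_image_eq _ σ.injective]; exact Q.2⟩
  invFun P := ⟨σ ⁻¹' P, P.2⟩
  left_inv Q := Subtype.ext (Set.preimage_image_eq _ σ.injective)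
  right_inv P := Subtype.ext (Set.image_preimage_eq _ σ.surjective)

/-- The restriction of `σ` to a bijection from `σ⁻¹(P)` onto `P`. -/
def restrictEquiv (σ : U ≃ V) (P : Set V) : (σ ⁻¹' P : Set U) ≃ P :=
  σ.subtypeEquiv fun _ => Iff.rfl

/-- Transport of a composite structure along a bijection of the label sets. -/
def map [Finite U] [Finite V] (σ : U ≃ V) (s : CompositeStructure F G U) : CompositeStructure F G V where
  parts := mapParts σ s.parts
  isPartition := isPartition_mapParts σ s.isPartition
  outer := F.map (partsEquiv σ s.parts) s.outer
  inner P := G.map (restrictEquiv σ P) (s.inner ⟨σ ⁻¹' (P : Set V), P.2⟩)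

/-- The weight of a composite structure: the weight of the outer structure times the product of the
weights of the structures on the classes. -/
def weight [Finite U] (s : CompositeStructure F G U) : ℝ≥0 :=
  F.weight s.outer * ∏ᶠ Q : s.parts, G.weight (s.inner Q)

end CompositeStructure

namespace WeightedSpecies

/-- The composition `F ∘ G` of two weighted species. -/
def comp (F : WeightedSpecies.{u}) (G : WeightedSpecies.{v}) : WeightedSpecies.{max u v} where
  obj U _ := CompositeStructure F G U
  finite_obj _ _ := inferInstance
  map σ := CompositeStructure.map σ
  map_refl := by
    intro U _ s
    refine CompositeStructure.ext rfl (heq_of_eq ?_) (heq_of_eq ?_)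
    · refine Eq.trans ?_ (F.map_refl s.outer)
      change F.map (CompositeStructure.partsEquiv (Equiv.refl U) s.parts) s.outer = _
      congr 1
      exact Equiv.ext fun Q => Subtype.ext (Set.image_id _)
    · funext P
      exact G.map_refl (s.inner P)
  map_trans := by
    intro U V W _ _ _ σ τ s
    refine CompositeStructure.ext rfl (heq_of_eq ?_) (heq_of_eq ?_)
    · refine Eq.trans ?_ (F.map_trans _ _ s.outer)
      change F.map (CompositeStructure.partsEquiv (σ.trans τ) s.parts) s.outer = _
      congr 1
      exact Equiv.ext fun Q => Subtype.ext (Set.image_comp τ σ _)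
    · funext P
      exact G.map_trans
        (CompositeStructure.restrictEquiv σ (τ ⁻¹' (P : Set W)))
        (CompositeStructure.restrictEquiv τ (P : Set W)) _
  weight s := s.weight
  weight_map := by
    intro U V _ _ σ s
    refine congrArg₂ (· * ·) (F.weight_map _ _) ?_
    refine Eq.trans (finprod_congr fun P => G.weight_map _ _) ?_
    exact finprod_comp_equiv (CompositeStructure.partsEquiv σ s.parts).symm
      (f := fun Q => G.weight (s.inner Q))

end WeightedSpecies

/-! ## Random structures -/

/-- The probability measure that picks `a` with probability proportional to `w a`
(meaningful when the total weight is positive and finite, and the zero measure otherwise). -/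
def proportionalLaw {α : Type u} [MeasurableSpace α] (w : α → ℝ≥0∞) : Measure α :=
  (∑' a, w a)⁻¹ • Measure.sum fun a => w a • Measure.dirac a

namespace WeightedSpecies

/-- The law of a random structure with label set of size `n`, drawn with probability proportional to
its weight. -/
def sizedLaw (A : WeightedSpecies.{u}) (n : ℕ) : Measure (A.obj (Fin n)) :=
  proportionalLaw fun x => (A.weight x : ℝ≥0∞)

/-- The Boltzmann law with parameter `y`: the probability of a structure `x` of size `n` is
proportional to `weight x * y ^ n / n!`. -/
def boltzmannLaw (A : WeightedSpecies.{u}) (y : ℝ) : Measure A.Universe :=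
  proportionalLaw fun x => ENNReal.ofReal ((A.weight x.2 : ℝ) * y ^ x.1 / (x.1.factorial : ℝ))

/-- The number of components of a composite structure. -/
def components {F : WeightedSpecies.{u}} {G : WeightedSpecies.{v}} {U : Type} [Finite U]
    (s : (F.comp G).obj U) : ℕ := CompositeStructure.numComponents s

end WeightedSpecies

/-- The total variation distance of two laws on a countable discrete space. -/
def tvDist {α : Type u} [MeasurableSpace α] (P Q : Measure α) : ℝ :=
  ⨆ E : Set α, |P.real E - Q.real E|

/-! ## Power series -/

/-- The radius of convergence of a real power series. -/
def seriesRadius (g : PowerSeries ℝ) : ℝ≥0∞ :=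
  (FormalMultilinearSeries.ofScalars ℝ fun n => PowerSeries.coeff n g).radius

/-- The value `∑ gₙ xⁿ` of a real power series at `x`. -/
def seriesValue (g : PowerSeries ℝ) (x : ℝ) : ℝ := ∑' n, PowerSeries.coeff n g * x ^ n

/-- The class of subexponential power series with span `d`, the radius of convergence being `ρ`. -/
structure IsSubexponential (d : ℕ) (g : PowerSeries ℝ) (ρ : ℝ) : Prop where
  one_le_span : 1 ≤ d
  coeff_nonneg : ∀ n, 0 ≤ PowerSeries.coeff n g
  radius_pos : 0 < ρ
  radius_eq : seriesRadius g = ENNReal.ofReal ρ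
  coeff_eq_zero : ∀ n, ¬ d ∣ n → PowerSeries.coeff n g = 0
  ratio : Tendsto (fun n => PowerSeries.coeff n g / PowerSeries.coeff (n + d) g)
    (atTop ⊓ 𝓟 {n | d ∣ n}) (𝓝 (ρ ^ d))
  summable : Summable fun n => PowerSeries.coeff n g * ρ ^ n
  convolution : Tendsto (fun n => (PowerSeries.coeff n g)⁻¹ *
      ∑ p ∈ Finset.HasAntidiagonal.antidiagonal n, PowerSeries.coeff p.1 g * PowerSeries.coeff p.2 g)
    (atTop ⊓ 𝓟 {n | d ∣ n}) (𝓝 (2 * seriesValue g ρ))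

end

noncomputable section

/-! ## Laws proportional to a weight function -/

section ProportionalLaw

/-! Write `f_k` for the coefficients of `F.egf`, `g` for `G.egf` and `s = g(ρ)`. The composites of
size `n` with `k` components have total weight `n! f_k [zⁿ] g^k` (`sum_weight_numComponents_eq`), so
after division by `n! [zⁿ] g` the law of `c(S_n)` is proportional to `f_k [zⁿ] g^k / [zⁿ] g`.

Subexponentiality says that a large composite has one giant component while the others stay bounded.
Hence `[zⁿ] g^k / [zⁿ] g → k s^(k-1)` for fixed `k` (`IsSubexponential.tendsto_coeff_pow`). On the
Boltzmann side, summing over all sizes gives the event `1 + c(R) = k` the weight `f'_{k-1} s^(k-1) =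
k f_k s^(k-1)`, where `f'_{k-1} = k f_k` is a coefficient of the derived series. The two laws
therefore agree in the limit, weight by weight.

To pass from weights to total variation and moments, `IsSubexponential.exists_coeff_pow_le` bounds
the ratios by `B (s + ε)^k` uniformly in `k` for all large `n`. Since `F.egf` converges beyond `s`,
the sequence `f_k B (s + ε)^k` has all moments for small `ε`, and dominated convergence
(`natLaw_tendsto`) concludes. -/

theorem proportionalLaw_apply {α : Type u} [MeasurableSpace α] (w : α → ℝ≥0∞) {s : Set α}
    (hs : MeasurableSet s) :
    proportionalLaw w s = (∑' a, w a)⁻¹ * ∑' a, w a * s.indicator 1 a := by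
  simp [proportionalLaw, Measure.sum_apply _ hs, Measure.dirac_apply' _ hs]

/-- Interchanging the two sums regroups the weights by the fibres of `c`; the normalising constant
is the same because it is the case `φ = 1` of `key`. -/
theorem map_proportionalLaw {α : Type u} [MeasurableSpace α] (w : α → ℝ≥0∞) {c : α → ℕ}
    (hc : Measurable c) :
    (proportionalLaw w).map c = proportionalLaw fun k => ∑' a, if c a = k then w a else 0 := by
  have key (φ : ℕ → ℝ≥0∞) :
      ∑' k, (∑' a, if c a = k then w a else 0) * φ k = ∑' a, w a * φ (c a) := by
    simp_rw [← ENNReal.tsum_mul_right]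
    rw [ENNReal.tsum_comm]
    refine tsum_congr fun a => ?_
    rw [tsum_eq_single (c a)]
    · simp
    · intro k hk
      simp [hk.symm]
  ext s hs
  rw [Measure.map_apply hc hs, proportionalLaw_apply _ (hc hs), proportionalLaw_apply _ hs, key]
  congr 2
  simpa using (key 1).symm

/-- Allows the weights of `c(S_n)` to be divided by `n! [zⁿ] g`, without which they would have no
limit in general. -/
theorem proportionalLaw_const_mul {α : Type u} [MeasurableSpace α] (w : α → ℝ≥0∞) {r : ℝ≥0∞}
    (h0 : r ≠ 0) (ht : r ≠ ⊤) : proportionalLaw (fun a => r * w a) = proportionalLaw w := by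
  ext s hs
  rw [proportionalLaw_apply _ hs, proportionalLaw_apply _ hs]
  simp_rw [mul_assoc, ENNReal.tsum_mul_left]
  rw [ENNReal.mul_inv (Or.inl h0) (Or.inl ht), mul_mul_mul_comm, ENNReal.inv_mul_cancel h0 ht,
    one_mul]

/-- The law on `ℕ` with point masses proportional to the non-negative numbers `a k`. -/
def natLaw (a : ℕ → ℝ) : Measure ℕ := proportionalLaw fun k => ENNReal.ofReal (a k)

variable {a : ℕ → ℝ}


theorem isProbabilityMeasure_natLaw (ha : ∀ k, 0 ≤ a k) (hs : Summable a) (hp : 0 < ∑' k, a k) :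
    IsProbabilityMeasure (natLaw a) := by
  constructor
  rw [natLaw, proportionalLaw_apply _ MeasurableSet.univ]
  simp only [Set.indicator_univ, Pi.one_apply, mul_one]
  rw [← ENNReal.ofReal_tsum_of_nonneg ha hs]
  exact ENNReal.inv_mul_cancel (by simpa using hp) ENNReal.ofReal_ne_top

theorem integral_natLaw (ha : ∀ k, 0 ≤ a k) (hs : Summable a) (hp : 0 < ∑' k, a k) (φ : ℕ → ℝ) :
    ∫ k, φ k ∂natLaw a = (∑' k, a k)⁻¹ * ∑' k, a k * φ k := by
  rw [natLaw, proportionalLaw, integral_smul_measure, integral_sum_dirac (fun _ => by simp),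
    ← ENNReal.ofReal_tsum_of_nonneg ha hs, ← ENNReal.ofReal_inv_of_pos hp,
    ENNReal.toReal_ofReal (inv_nonneg.2 hp.le), smul_eq_mul]
  simp only [ENNReal.toReal_ofReal (ha _), smul_eq_mul]

theorem integrable_natLaw (ha : ∀ k, 0 ≤ a k) (hs : Summable a) (hp : 0 < ∑' k, a k) {φ : ℕ → ℝ}
    (hφ : ∀ k, 0 ≤ φ k) (h : Summable fun k => a k * φ k) : Integrable φ (natLaw a) := by
  rw [natLaw, proportionalLaw]
  refine Integrable.smul_measure ?_ ?_
  · refine ⟨by fun_prop, ?_⟩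
    rw [hasFiniteIntegral_iff_enorm, lintegral_sum_measure]
    simp only [lintegral_smul_measure, lintegral_dirac, smul_eq_mul]
    have : ∀ k, ENNReal.ofReal (a k) * ‖φ k‖ₑ = ENNReal.ofReal (a k * φ k) := fun k => by
      rw [Real.enorm_of_nonneg (hφ k), ENNReal.ofReal_mul (ha k)]
    simp_rw [this]
    rw [← ENNReal.ofReal_tsum_of_nonneg (fun k => mul_nonneg (ha k) (hφ k)) h]
    exact ENNReal.ofReal_lt_top
  · rw [← ENNReal.ofReal_tsum_of_nonneg ha hs]
    simpa using hp

theorem measureReal_natLaw (ha : ∀ k, 0 ≤ a k) (hs : Summable a) (hp : 0 < ∑' k, a k)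
    (E : Set ℕ) : (natLaw a).real E = ∑' k, a k / (∑' k, a k) * E.indicator 1 k := by
  have h := integral_natLaw ha hs hp (E.indicator 1)
  rw [integral_indicator_one (MeasurableSet.of_discrete)] at h
  rw [h, ← tsum_mul_left]
  exact tsum_congr fun k => by ring

/-- The `ℓ¹` distance of the point masses bounds every event; the optimal factor `1/2` is not
needed. -/
theorem tvDist_natLaw_le {b : ℕ → ℝ} (ha : ∀ k, 0 ≤ a k) (hs : Summable a) (hp : 0 < ∑' k, a k)
    (hb : ∀ k, 0 ≤ b k) (hsb : Summable b) (hpb : 0 < ∑' k, b k) :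
    tvDist (natLaw a) (natLaw b) ≤ ∑' k, |a k / (∑' k, a k) - b k / (∑' k, b k)| := by
  have h1 := hs.div_const (∑' k, a k)
  have h2 := hsb.div_const (∑' k, b k)
  have hsum : Summable fun k => |a k / (∑' k, a k) - b k / (∑' k, b k)| := (h1.sub h2).abs
  refine ciSup_le fun E => ?_
  have ind (c : ℕ → ℝ) (hc : Summable c) : Summable fun k => c k * E.indicator 1 k := by
    refine (hc.indicator E).congr fun k => ?_
    by_cases hk : k ∈ E <;> simp [hk]
  rw [measureReal_natLaw ha hs hp, measureReal_natLaw hb hsb hpb,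
    ← (ind _ h1).tsum_sub (ind _ h2)]
  simp_rw [← sub_mul]
  refine (norm_tsum_le_tsum_norm (ind _ (h1.sub h2)).norm).trans ?_
  refine (ind _ (h1.sub h2)).norm.tsum_le_tsum (fun k => ?_) hsum
  by_cases hk : k ∈ E <;> simp [hk]

theorem tvDist_nonneg {α : Type u} [MeasurableSpace α] (P Q : Measure α) : 0 ≤ tvDist P Q :=
  Real.iSup_nonneg fun _ => abs_nonneg _

theorem tendsto_tsum_mul_of_dominated {ι : Type*} {l : Filter ι} {A : ι → ℕ → ℝ} {b D φ : ℕ → ℝ}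
    (hA : ∀ᶠ n in l, ∀ k, 0 ≤ A n k) (hAb : ∀ k, Tendsto (A · k) l (𝓝 (b k)))
    (hAD : ∀ᶠ n in l, ∀ k, A n k ≤ D k) (hφ : ∀ k, 0 ≤ φ k) (hD : Summable fun k => D k * φ k) :
    Tendsto (fun n => ∑' k, A n k * φ k) l (𝓝 (∑' k, b k * φ k)) := by
  refine tendsto_tsum_of_dominated_convergence hD (fun k => (hAb k).mul_const _) ?_
  filter_upwards [hA, hAD] with n h1 h2 k
  rw [Real.norm_of_nonneg (mul_nonneg (h1 k) (hφ k))]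
  exact mul_le_mul_of_nonneg_right (h2 k) (hφ k)

/-- Pointwise convergence of the weights with a dominating sequence having all moments gives
convergence of the laws in total variation and of all moments. -/
theorem natLaw_tendsto {ι : Type*} {l : Filter ι} {A : ι → ℕ → ℝ} {b D : ℕ → ℝ}
    (hA : ∀ᶠ n in l, ∀ k, 0 ≤ A n k) (hb : ∀ k, 0 ≤ b k) (hAb : ∀ k, Tendsto (A · k) l (𝓝 (b k)))
    (hAD : ∀ᶠ n in l, ∀ k, A n k ≤ D k) (hbD : ∀ k, b k ≤ D k)
    (hD : ∀ m : ℕ, Summable fun k => D k * (k : ℝ) ^ m) (hpos : 0 < ∑' k, b k) :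
    (∀ᶠ n in l, IsProbabilityMeasure (natLaw (A n))) ∧ IsProbabilityMeasure (natLaw b) ∧
    Tendsto (fun n => tvDist (natLaw (A n)) (natLaw b)) l (𝓝 0) ∧
    ∀ m : ℕ, Integrable (fun k : ℕ => (k : ℝ) ^ m) (natLaw b) ∧
      Tendsto (fun n => ∫ k : ℕ, (k : ℝ) ^ m ∂natLaw (A n)) l (𝓝 (∫ k : ℕ, (k : ℝ) ^ m ∂natLaw b)) := by
  have hD0 : Summable D := by simpa using hD 0
  have hsb : Summable b := .of_nonneg_of_le hb hbD hD0
  have hsA : ∀ᶠ n in l, Summable (A n) := by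
    filter_upwards [hA, hAD] with n h1 h2
    exact .of_nonneg_of_le h1 h2 hD0
  have hsum : Tendsto (fun n => ∑' k, A n k) l (𝓝 (∑' k, b k)) := by
    simpa using tendsto_tsum_mul_of_dominated (φ := fun _ => 1) hA hAb hAD (by simp) (by simpa)
  -- Keeping the total mass above half its limit gives a bound on the normalised weights that does
  -- not depend on `n`.
  have hhalf : ∀ᶠ n in l, (∑' k, b k) / 2 < ∑' k, A n k :=
    hsum.eventually (lt_mem_nhds (half_lt_self hpos))
  have hposA : ∀ᶠ n in l, 0 < ∑' k, A n k :=
    hhalf.mono fun n h => (half_pos hpos).trans h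
  refine ⟨?_, isProbabilityMeasure_natLaw hb hsb hpos, ?_, fun m => ⟨?_, ?_⟩⟩
  · filter_upwards [hA, hsA, hposA] with n h1 h2 h3
    exact isProbabilityMeasure_natLaw h1 h2 h3
  · have hlim : Tendsto (fun n => ∑' k, |A n k / (∑' k, A n k) - b k / (∑' k, b k)|) l (𝓝 0) := by
      have : Tendsto (fun n => ∑' k, |A n k / (∑' k, A n k) - b k / (∑' k, b k)|) l
          (𝓝 (∑' _ : ℕ, (0 : ℝ))) := by
        refine tendsto_tsum_of_dominated_convergence
          (bound := fun k => D k / ((∑' k, b k) / 2) + b k / (∑' k, b k))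
          ((hD0.div_const _).add (hsb.div_const _)) (fun k => ?_) ?_
        · have := (((hAb k).div hsum hpos.ne').sub_const (b k / (∑' k, b k))).abs
          simpa using this
        · filter_upwards [hA, hAD, hhalf] with n h1 h2 h3 k
          have h4 := half_pos hpos
          rw [Real.norm_of_nonneg (abs_nonneg _)]
          refine (abs_sub _ _).trans ?_
          rw [abs_of_nonneg (div_nonneg (h1 k) (h4.trans h3).le),
            abs_of_nonneg (div_nonneg (hb k) hpos.le)]
          gcongr
          · exact (h1 k).trans (h2 k)
          · exact h2 k
      simpa using this
    refine tendsto_of_tendsto_of_tendsto_of_le_of_le' tendsto_const_nhds hlim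
      (.of_forall fun n => tvDist_nonneg _ _) ?_
    filter_upwards [hA, hsA, hposA] with n h1 h2 h3
    exact tvDist_natLaw_le h1 h2 h3 hb hsb hpos
  · refine integrable_natLaw hb hsb hpos (fun k => by positivity) ?_
    exact .of_nonneg_of_le (fun k => mul_nonneg (hb k) (by positivity))
      (fun k => mul_le_mul_of_nonneg_right (hbD k) (by positivity)) (hD m)
  · rw [integral_natLaw hb hsb hpos]
    refine Tendsto.congr' ?_ ((hsum.inv₀ hpos.ne').mul
      (tendsto_tsum_mul_of_dominated hA hAb hAD (fun k => by positivity) (hD m)))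
    filter_upwards [hA, hsA, hposA] with n h1 h2 h3
    rw [integral_natLaw h1 h2 h3]

end ProportionalLaw

/-! ## Powers of subexponential power series -/

section Subexponential

open PowerSeries

theorem PowerSeries.coeff_mul_eq_sum_range {R : Type*} [Semiring R] (u v : PowerSeries R) (n : ℕ) :
    coeff n (u * v) = ∑ i ∈ Finset.range (n + 1), coeff i u * coeff (n - i) v := by
  rw [coeff_mul]
  exact Finset.Nat.sum_antidiagonal_eq_sum_range_succ (fun i j => coeff i u * coeff j v) n

theorem PowerSeries.coeff_pow_nonneg {q : PowerSeries ℝ} (hq : ∀ n, 0 ≤ coeff n q) (k n : ℕ) :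
    0 ≤ coeff n (q ^ k) := by
  induction k generalizing n with
  | zero =>
    rw [pow_zero, coeff_one]
    split_ifs <;> norm_num
  | succ k ih =>
    rw [pow_succ, coeff_mul]
    exact Finset.sum_nonneg fun p _ => mul_nonneg (ih _) (hq _)

theorem PowerSeries.hasSum_coeff_pow {q : PowerSeries ℝ} {s : ℝ}
    (hs : HasSum (fun n => coeff n q) s) (k : ℕ) : HasSum (fun n => coeff n (q ^ k)) (s ^ k) := by
  induction k with
  | zero =>
    simp only [pow_zero, coeff_one]
    exact hasSum_ite_eq 0 1
  | succ k ih =>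
    have h1 : Summable fun n => ‖coeff n (q ^ k)‖ := ih.summable.norm
    have h2 : Summable fun n => ‖coeff n q‖ := hs.summable.norm
    have h3 := (summable_norm_sum_mul_antidiagonal_of_summable_norm h1 h2).of_norm
    have h4 := tsum_mul_tsum_eq_tsum_sum_antidiagonal_of_summable_norm h1 h2
    rw [ih.tsum_eq, hs.tsum_eq] at h4
    rw [pow_succ s, h4]
    simpa only [pow_succ, coeff_mul] using h3.hasSum

/-- Series with non-negative coefficients that are subexponential at radius `1` with span `1`. -/
structure IsSubexpSeq (q : PowerSeries ℝ) (s : ℝ) : Prop where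
  nonneg : ∀ n, 0 ≤ coeff n q
  hasSum : HasSum (fun n => coeff n q) s
  pos : ∀ᶠ n in atTop, 0 < coeff n q
  ratio : Tendsto (fun n => coeff n q / coeff (n + 1) q) atTop (𝓝 1)
  sq : Tendsto (fun n => coeff n (q ^ 2) / coeff n q) atTop (𝓝 (2 * s))

namespace IsSubexpSeq

variable {q : PowerSeries ℝ} {s : ℝ}

theorem sum_pos (h : IsSubexpSeq q s) : 0 < s := by
  obtain ⟨n, hn⟩ := h.pos.exists
  exact hn.trans_le (le_hasSum h.hasSum n fun m _ => h.nonneg m)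

theorem tendsto_shift_add (h : IsSubexpSeq q s) (i : ℕ) :
    Tendsto (fun n => coeff n q / coeff (n + i) q) atTop (𝓝 1) := by
  induction i with
  | zero =>
    refine tendsto_const_nhds.congr' ?_
    filter_upwards [h.pos] with n hn
    simp [hn.ne']
  | succ i ih =>
    have h1 := ih.mul ((tendsto_add_atTop_iff_nat i).2 h.ratio)
    rw [one_mul] at h1
    refine h1.congr' ?_
    filter_upwards [(tendsto_add_atTop_nat i).eventually h.pos] with n hn
    rw [div_mul_div_cancel₀ hn.ne', add_assoc]

theorem tendsto_shift (h : IsSubexpSeq q s) (i : ℕ) :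
    Tendsto (fun n => coeff (n - i) q / coeff n q) atTop (𝓝 1) := by
  rw [← tendsto_add_atTop_iff_nat i]
  simpa using h.tendsto_shift_add i

theorem tendsto_head (h : IsSubexpSeq q s) (r : ℕ → ℝ) (M : ℕ) :
    Tendsto (fun n => (∑ i ∈ Finset.range M, r i * coeff (n - i) q) / coeff n q) atTop
      (𝓝 (∑ i ∈ Finset.range M, r i)) := by
  simp_rw [Finset.sum_div, mul_div_assoc]
  refine tendsto_finsetSum _ fun i _ => ?_
  simpa using (h.tendsto_shift i).const_mul (r i)

/-- For `i` below a fixed `M`, `q_{n-i} / q_n → 1` yields the partial sum of `r`. For `i ≥ M`,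
`|r_i| ≤ δ q_i` bounds the tail by `δ [zⁿ] q²`, which is at most `δ (2s + 1) q_n` eventually. -/
theorem tendsto_conv_of_isLittleO (h : IsSubexpSeq q s) {r : ℕ → ℝ} {t : ℝ} (hr : HasSum r t)
    (hrq : Tendsto (fun n => r n / coeff n q) atTop (𝓝 0)) :
    Tendsto (fun n => (∑ i ∈ Finset.range (n + 1), r i * coeff (n - i) q) / coeff n q) atTop
      (𝓝 t) := by
  have hs := h.sum_pos
  refine Metric.tendsto_nhds.2 fun ε hε => ?_
  obtain ⟨δ, hδ, hδε⟩ : ∃ δ > 0, δ * (2 * s + 1) < ε / 3 :=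
    ⟨ε / 6 / (2 * s + 1), by positivity, by
      rw [div_mul_cancel₀ _ (by positivity)]; linarith⟩
  have hsmall : ∀ᶠ n in atTop, |r n| ≤ δ * coeff n q := by
    filter_upwards [hrq.eventually (Metric.ball_mem_nhds 0 hδ), h.pos] with n hn hp
    rw [dist_zero_right, Real.norm_eq_abs, abs_div, abs_of_pos hp,
      div_lt_iff₀ hp] at hn
    exact hn.le
  have hpart : ∀ᶠ M in atTop, |∑ i ∈ Finset.range M, r i - t| < ε / 3 := by
    simpa [Real.dist_eq] using hr.tendsto_sum_nat.eventually
      (Metric.ball_mem_nhds t (by positivity : 0 < ε / 3))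
  obtain ⟨M, hM, hMt⟩ := ((eventually_forall_ge_atTop.2 hsmall).and hpart).exists
  have hhead : ∀ᶠ n in atTop, |(∑ i ∈ Finset.range M, r i * coeff (n - i) q) / coeff n q -
      ∑ i ∈ Finset.range M, r i| < ε / 3 := by
    simpa [Real.dist_eq] using (h.tendsto_head r M).eventually
      (Metric.ball_mem_nhds _ (by positivity : 0 < ε / 3))
  have hsq : ∀ᶠ n in atTop, coeff n (q ^ 2) / coeff n q < 2 * s + 1 :=
    h.sq.eventually (gt_mem_nhds (by linarith))
  filter_upwards [hhead, hsq, h.pos, eventually_ge_atTop M] with n h1 h2 h3 h4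
  have htail : |∑ i ∈ Finset.Ico M (n + 1), r i * coeff (n - i) q| ≤ δ * coeff n (q ^ 2) := by
    refine (Finset.abs_sum_le_sum_abs _ _).trans ?_
    rw [pow_two, coeff_mul_eq_sum_range, Finset.mul_sum]
    refine (Finset.sum_le_sum fun i hi => ?_).trans
      (Finset.sum_le_sum_of_subset_of_nonneg (s := Finset.Ico M (n + 1)) ?_ fun i _ _ => ?_)
    · rw [abs_mul, abs_of_nonneg (h.nonneg _), ← mul_assoc]
      exact mul_le_mul_of_nonneg_right (hM i (Finset.mem_Ico.1 hi).1) (h.nonneg _)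
    · intro i hi
      exact Finset.mem_range.2 (Finset.mem_Ico.1 hi).2
    · exact mul_nonneg hδ.le (mul_nonneg (h.nonneg _) (h.nonneg _))
  have htail' : |(∑ i ∈ Finset.Ico M (n + 1), r i * coeff (n - i) q) / coeff n q| < ε / 3 := by
    rw [abs_div, abs_of_pos h3]
    calc _ ≤ δ * coeff n (q ^ 2) / coeff n q := by gcongr
      _ = δ * (coeff n (q ^ 2) / coeff n q) := by ring
      _ ≤ δ * (2 * s + 1) := by gcongr
      _ < ε / 3 := hδε
  rw [Real.dist_eq, ← Finset.sum_range_add_sum_Ico _ (by omega : M ≤ n + 1), add_div]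
  rw [abs_lt] at *
  constructor <;> linarith [h1.1, h1.2, hMt.1, hMt.2, htail'.1, htail'.2]

/-- Induction on `k`: write `q^k = c q + r` with `c = k s^(k-1)` and `r = o(q)`. In `q^(k+1) = c q²
+ r q` the first term contributes `2sc`, and the second the sum `s^k - cs` of the coefficients of
`r`. -/
theorem tendsto_coeff_pow (h : IsSubexpSeq q s) (k : ℕ) :
    Tendsto (fun n => coeff n (q ^ k) / coeff n q) atTop (𝓝 (k * s ^ (k - 1))) := by
  induction k with
  | zero =>
    refine tendsto_const_nhds.congr' ?_
    filter_upwards [eventually_gt_atTop 0] with n hn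
    simp [coeff_one, hn.ne']
  | succ k ih =>
    set c : ℝ := k * s ^ (k - 1) with hc
    have hr := (hasSum_coeff_pow h.hasSum k).sub (h.hasSum.mul_left c)
    have h0 : Tendsto (fun n => (coeff n (q ^ k) - c * coeff n q) / coeff n q) atTop (𝓝 0) := by
      have := ih.sub_const c
      rw [sub_self] at this
      refine this.congr' ?_
      filter_upwards [h.pos] with n hn
      field_simp
    have h1 := (h.tendsto_conv_of_isLittleO hr h0).add (h.sq.const_mul c)
    have hlim : s ^ k - c * s + c * (2 * s) = ((k + 1 : ℕ) : ℝ) * s ^ (k + 1 - 1) := by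
      -- The case `k = 0` is separate because the exponent `k - 1` is truncated; there `c = 0`.
      rw [hc]
      rcases k with _ | k
      · simp
      · simp only [Nat.add_sub_cancel]
        push_cast
        ring
    rw [hlim] at h1
    refine h1.congr fun n => ?_
    rw [pow_succ q k, pow_two, coeff_mul_eq_sum_range, coeff_mul_eq_sum_range, ← mul_div_assoc,
      ← add_div, Finset.mul_sum, ← Finset.sum_add_distrib]
    congr 1
    exact Finset.sum_congr rfl fun i _ => by ring

/-- A bound of Kesten type, by induction on `k` for all `n ≥ M` at once. The convolution of `q^k`
with `q` is cut at `M`. For `i ≥ M` the induction hypothesis costs a factor `s + ε/2`, since the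
tail of `[zⁿ] q²` is below `(s + ε/2) q_n`. For `i < M` one has `q_{n-i} ≤ 2 q_n`, and the
coefficients of `q^k` sum to `s^k`. The extra term `C s^k` is absorbed by raising `s + ε/2` to `s +
ε`. -/
theorem exists_coeff_pow_le (h : IsSubexpSeq q s) {ε : ℝ} (hε : 0 < ε) :
    ∃ B : ℝ, 0 ≤ B ∧ ∀ᶠ n in atTop, ∀ k : ℕ,
      coeff n (q ^ k) ≤ B * (s + ε) ^ k * coeff n q := by
  have hs := h.sum_pos
  have hpart : ∀ᶠ M in atTop, s - ε / 4 < ∑ i ∈ Finset.range M, coeff i q :=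
    h.hasSum.tendsto_sum_nat.eventually (lt_mem_nhds (by linarith))
  obtain ⟨M, hMpos, hMs, hM1⟩ :=
    ((eventually_forall_ge_atTop.2 h.pos).and (hpart.and (eventually_ge_atTop 1))).exists
  have htail : ∀ᶠ n in atTop, coeff n (q ^ 2) / coeff n q -
      (∑ i ∈ Finset.range M, coeff i q * coeff (n - i) q) / coeff n q < s + ε / 2 :=
    (h.sq.sub (h.tendsto_head _ M)).eventually (gt_mem_nhds (by linarith))
  have hshift : ∀ᶠ n in atTop, ∀ i ∈ Finset.range M, coeff (n - i) q / coeff n q < 2 :=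
    (Finset.eventually_all _).2 fun i _ => (h.tendsto_shift i).eventually (gt_mem_nhds (by norm_num))
  obtain ⟨N, hN, hNM⟩ := ((eventually_forall_ge_atTop.2 (htail.and hshift)).and
    (eventually_ge_atTop M)).exists
  -- The `2` serves the head of the convolution when `n ≥ N`; the finite sum serves `M ≤ n < N`,
  -- where only `[zⁿ] q^(k+1) ≤ s^(k+1)` is available.
  set C : ℝ := 2 + ∑ n ∈ Finset.Ico M N, s / coeff n q with hC
  have hterm : ∀ n ∈ Finset.Ico M N, 0 ≤ s / coeff n q := fun n _ => div_nonneg hs.le (h.nonneg n)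
  have hC2 : 2 ≤ C := by
    have := Finset.sum_nonneg hterm
    linarith
  refine ⟨C / (ε / 2), by positivity, ?_⟩
  filter_upwards [eventually_ge_atTop M] with n hn k
  induction k generalizing n with
  | zero =>
    -- `M ≥ 1` was imposed so that the constant series `q^0` vanishes at every `n ≥ M`.
    rw [pow_zero, coeff_one, if_neg (by omega)]
    have := h.nonneg n
    positivity
  | succ k ih =>
    set A : ℝ := C / (ε / 2) * (s + ε) ^ k with hA
    have hA0 : 0 ≤ A := by positivity
    have hstep : A * (s + ε / 2) + C * s ^ k ≤ C / (ε / 2) * (s + ε) ^ (k + 1) := by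
      have h1 : C * s ^ k ≤ A * (ε / 2) := by
        rw [hA, mul_right_comm, div_mul_cancel₀ _ (by positivity)]
        gcongr
        linarith
      calc _ ≤ A * (s + ε / 2) + A * (ε / 2) := by gcongr
        _ = _ := by rw [hA]; ring
    have hsumk := hasSum_coeff_pow h.hasSum k
    have hq := hMpos n hn
    refine le_trans ?_ (mul_le_mul_of_nonneg_right hstep hq.le)
    rcases lt_or_ge n N with hlt | hge
    · have h1 : coeff n (q ^ (k + 1)) ≤ s ^ (k + 1) :=
        le_hasSum (hasSum_coeff_pow h.hasSum (k + 1)) n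
          fun m _ => coeff_pow_nonneg h.nonneg _ m
      have h2 : s / coeff n q ≤ C := by
        have := Finset.single_le_sum hterm (Finset.mem_Ico.2 ⟨hn, hlt⟩)
        linarith
      rw [div_le_iff₀ hq] at h2
      calc _ ≤ s ^ (k + 1) := h1
        _ = s ^ k * s := pow_succ _ _
        _ ≤ s ^ k * (C * coeff n q) := by gcongr
        _ ≤ A * (s + ε / 2) * coeff n q + s ^ k * (C * coeff n q) := by
          have : 0 ≤ A * (s + ε / 2) * coeff n q := by positivity
          linarith
        _ = _ := by ring
    · obtain ⟨h1, h2⟩ := hN n hge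
      have hhead : ∑ i ∈ Finset.range M, coeff i (q ^ k) * coeff (n - i) q ≤
          C * s ^ k * coeff n q := by
        calc _ ≤ ∑ i ∈ Finset.range M, coeff i (q ^ k) * (2 * coeff n q) := by
              refine Finset.sum_le_sum fun i hi => ?_
              have := (div_lt_iff₀ hq).1 (h2 i hi)
              exact mul_le_mul_of_nonneg_left this.le (coeff_pow_nonneg h.nonneg _ _)
          _ = 2 * (∑ i ∈ Finset.range M, coeff i (q ^ k)) * coeff n q := by
              rw [← Finset.sum_mul]; ring
          _ ≤ C * s ^ k * coeff n q := by
              gcongr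
              · exact Finset.sum_nonneg fun i _ => coeff_pow_nonneg h.nonneg _ _
              · exact sum_le_hasSum _ (fun i _ => coeff_pow_nonneg h.nonneg _ _) hsumk
      have hrest : ∑ i ∈ Finset.Ico M (n + 1), coeff i (q ^ k) * coeff (n - i) q ≤
          A * (s + ε / 2) * coeff n q := by
        rw [← sub_div, div_lt_iff₀ hq, pow_two, coeff_mul_eq_sum_range,
          ← Finset.sum_range_add_sum_Ico _ (by omega : M ≤ n + 1), add_sub_cancel_left] at h1
        calc _ ≤ ∑ i ∈ Finset.Ico M (n + 1), A * (coeff i q * coeff (n - i) q) := by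
              refine Finset.sum_le_sum fun i hi => ?_
              rw [← mul_assoc]
              exact mul_le_mul_of_nonneg_right (ih i (Finset.mem_Ico.1 hi).1) (h.nonneg _)
          _ = A * ∑ i ∈ Finset.Ico M (n + 1), coeff i q * coeff (n - i) q := by
              rw [Finset.mul_sum]
          _ ≤ A * ((s + ε / 2) * coeff n q) := by gcongr
          _ = _ := by ring
      rw [pow_succ q k, coeff_mul_eq_sum_range,
        ← Finset.sum_range_add_sum_Ico _ (by omega : M ≤ n + 1), add_mul]
      linarith

end IsSubexpSeq

/-! ### Reduction from span `d` and radius `ρ` to span and radius one -/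

/-- The series with coefficients `g_{d n} ρ ^ {d n}`. -/
def spanSeries (d : ℕ) (g : PowerSeries ℝ) (ρ : ℝ) : PowerSeries ℝ :=
  mk fun m => coeff (d * m) g * ρ ^ (d * m)

theorem coeff_spanSeries (d : ℕ) (g : PowerSeries ℝ) (ρ : ℝ) (n : ℕ) :
    coeff n (spanSeries d g ρ) = coeff (d * n) g * ρ ^ (d * n) := coeff_mk _ _

theorem atTop_inf_principal_dvd {d : ℕ} (hd : 1 ≤ d) :
    (atTop ⊓ 𝓟 {n : ℕ | d ∣ n}) = map (fun m : ℕ => d * m) atTop := by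
  ext S
  simp only [mem_inf_principal, mem_map, mem_atTop_sets, Set.mem_ofPred_eq, Set.mem_preimage]
  constructor
  · rintro ⟨a, ha⟩
    exact ⟨a, fun b hb => ha (d * b) (by nlinarith) (dvd_mul_right d b)⟩
  · rintro ⟨a, ha⟩
    refine ⟨d * a, ?_⟩
    rintro _ hb ⟨c, rfl⟩
    exact ha c (Nat.le_of_mul_le_mul_left hb hd)

namespace IsSubexponential

variable {d : ℕ} {g : PowerSeries ℝ} {ρ : ℝ}

/-- `g(ρz)` is the span series evaluated at `z^d`, and both substitutions are ring homomorphisms, so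
they commute with powers. -/
theorem coeff_pow_mul_pow (h : IsSubexponential d g ρ) (k n : ℕ) :
    coeff (d * n) (g ^ k) * ρ ^ (d * n) =
      coeff n (spanSeries d g ρ ^ k) := by
  have hd : d ≠ 0 := by have := h.one_le_span; omega
  have hexp : rescale ρ g = expand d hd (spanSeries d g ρ) := by
    ext n
    rw [coeff_rescale]
    by_cases hn : d ∣ n
    · obtain ⟨m, rfl⟩ := hn
      rw [coeff_expand_mul, coeff_spanSeries, mul_comm]
    · rw [coeff_expand_of_not_dvd _ _ _ hn, h.coeff_eq_zero n hn, mul_zero]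
  rw [mul_comm, ← coeff_rescale, map_pow, hexp, ← map_pow, coeff_expand_mul]

theorem hasSum_span (h : IsSubexponential d g ρ) :
    HasSum (fun n => coeff (d * n) g * ρ ^ (d * n)) (seriesValue g ρ) := by
  have hd : d ≠ 0 := by have := h.one_le_span; omega
  have hinj : Function.Injective fun n : ℕ => d * n := mul_right_injective₀ hd
  refine (hinj.hasSum_iff ?_).2 h.summable.hasSum
  intro n hn
  rw [h.coeff_eq_zero n, zero_mul]
  rintro ⟨m, rfl⟩
  exact hn ⟨m, rfl⟩

/-- A vanishing sum of non-negative terms would force `g = 0`, whose radius is infinite rather than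
`ρ`. -/
theorem seriesValue_pos (h : IsSubexponential d g ρ) : 0 < seriesValue g ρ := by
  have h0 (n : ℕ) : 0 ≤ coeff n g * ρ ^ n :=
    mul_nonneg (h.coeff_nonneg n) (pow_nonneg h.radius_pos.le n)
  refine (tsum_nonneg h0).lt_of_ne fun heq => ?_
  have hz : (fun n => coeff n g * ρ ^ n) = 0 :=
    (hasSum_zero_iff_of_nonneg h0).1 (heq ▸ h.summable.hasSum)
  have hg : ∀ n, coeff n g = 0 := fun n => by
    have := congrFun hz n
    simpa [(pow_pos h.radius_pos n).ne'] using this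
  have hr := h.radius_eq
  have htop : seriesRadius g = ⊤ := by
    refine FormalMultilinearSeries.radius_eq_top_of_forall_nnreal_isBigO _ fun r => ?_
    simpa [FormalMultilinearSeries.ofScalars, hg] using isBoundedUnder_const
  rw [htop] at hr
  exact ENNReal.ofReal_ne_top hr.symm

theorem isSubexpSeq (h : IsSubexponential d g ρ) :
    IsSubexpSeq (spanSeries d g ρ) (seriesValue g ρ) := by
  have hρ := h.radius_pos
  have hconv := h.convolution
  have hratio := h.ratio
  rw [atTop_inf_principal_dvd h.one_le_span, tendsto_map'_iff] at hconv hratio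
  refine ⟨fun n => ?_, ?_, ?_, ?_, ?_⟩
  · rw [coeff_spanSeries]
    exact mul_nonneg (h.coeff_nonneg _) (by positivity)
  · simpa only [coeff_spanSeries] using h.hasSum_span
  -- If `g_n = 0`, the convention `0⁻¹ = 0` makes the convolution quotient zero, which is excluded
  -- for large `n` by its positive limit `2 g(ρ)`.
  · filter_upwards [hconv.eventually (lt_mem_nhds (mul_pos two_pos h.seriesValue_pos))] with n hn
    rw [coeff_spanSeries]
    refine mul_pos ((h.coeff_nonneg _).lt_of_ne fun h0 => ?_) (by positivity)
    simp [← h0] at hn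
  · have := hratio.div_const (ρ ^ d)
    rw [div_self (by positivity)] at this
    refine this.congr fun n => ?_
    simp only [Function.comp, coeff_spanSeries, mul_add, mul_one, pow_add]
    field_simp
  · refine hconv.congr fun n => ?_
    rw [← h.coeff_pow_mul_pow, coeff_spanSeries, mul_div_mul_right _ _ (by positivity), pow_two, coeff_mul]
    simp only [Function.comp]
    rw [mul_comm, div_eq_mul_inv]

theorem coeff_pow_div (h : IsSubexponential d g ρ) (k n : ℕ) :
    coeff (d * n) (g ^ k) / coeff (d * n) g =
      coeff n (spanSeries d g ρ ^ k) /
        coeff n (spanSeries d g ρ) := by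
  have hρ := h.radius_pos
  rw [← h.coeff_pow_mul_pow, coeff_spanSeries, mul_div_mul_right _ _ (by positivity)]

theorem eventually_coeff_pos (h : IsSubexponential d g ρ) :
    ∀ᶠ n in atTop ⊓ 𝓟 {n : ℕ | d ∣ n}, 0 < coeff n g := by
  rw [atTop_inf_principal_dvd h.one_le_span, eventually_map]
  filter_upwards [h.isSubexpSeq.pos] with n hn
  rw [coeff_spanSeries] at hn
  exact pos_of_mul_pos_left hn (pow_pos h.radius_pos _).le

theorem tendsto_coeff_pow (h : IsSubexponential d g ρ) (k : ℕ) :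
    Tendsto (fun n => coeff n (g ^ k) / coeff n g) (atTop ⊓ 𝓟 {n : ℕ | d ∣ n})
      (𝓝 (k * seriesValue g ρ ^ (k - 1))) := by
  rw [atTop_inf_principal_dvd h.one_le_span, tendsto_map'_iff]
  exact (h.isSubexpSeq.tendsto_coeff_pow k).congr fun n => (h.coeff_pow_div k n).symm

theorem exists_coeff_pow_le (h : IsSubexponential d g ρ) {ε : ℝ} (hε : 0 < ε) :
    ∃ B : ℝ, 0 ≤ B ∧ ∀ᶠ n in atTop ⊓ 𝓟 {n : ℕ | d ∣ n}, ∀ k : ℕ,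
      coeff n (g ^ k) / coeff n g ≤ B * (seriesValue g ρ + ε) ^ k := by
  obtain ⟨B, hB, hle⟩ := h.isSubexpSeq.exists_coeff_pow_le hε
  refine ⟨B, hB, ?_⟩
  rw [atTop_inf_principal_dvd h.one_le_span, eventually_map]
  filter_upwards [hle, h.isSubexpSeq.pos] with n hn hp k
  rw [h.coeff_pow_div, div_le_iff₀ hp]
  exact hn k

theorem hasSum_coeff_pow (h : IsSubexponential d g ρ) (k : ℕ) :
    HasSum (fun n => coeff n (g ^ k) * ρ ^ n) (seriesValue g ρ ^ k) := by
  have h1 : HasSum (fun n => coeff n (rescale ρ g)) (seriesValue g ρ) := by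
    simpa only [coeff_rescale, mul_comm, seriesValue] using h.summable.hasSum
  have h2 := PowerSeries.hasSum_coeff_pow h1 k
  simpa only [← map_pow, coeff_rescale, mul_comm] using h2

end IsSubexponential

end Subexponential

/-! ## Enumeration of composite structures by the number of components -/

section Colorings

open PowerSeries

/-- Let `L` be the linear functional sending the monomial `X^m` to `∏ a (m i)`, and evaluate it on
`(∑ X_i)^n` in two ways. Expanding the product gives one term per colouring; the multinomial theorem
gives the coefficient of the `k`-th power. -/
theorem sum_coloring_eq_coeff_pow (U : Type*) [Fintype U] [DecidableEq U] (k : ℕ) (a : ℕ → ℝ) :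
    ∑ c : U → Fin k, ∏ i, a (Nat.card (c ⁻¹' {i})) =
      ((Fintype.card U).factorial : ℝ) *
        coeff (Fintype.card U) ((mk fun n => a n / (n.factorial : ℝ)) ^ k) := by
  set n := Fintype.card U
  let L : MvPolynomial (Fin k) ℝ →ₗ[ℝ] ℝ :=
    (MvPolynomial.basisMonomials (Fin k) ℝ).constr ℝ fun m => ∏ i, a (m i)
  have hL (m : Fin k →₀ ℕ) : L (MvPolynomial.monomial m 1) = ∏ i, a (m i) := by
    have := (MvPolynomial.basisMonomials (Fin k) ℝ).constr_basis ℝ (fun m => ∏ i, a (m i)) m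
    rwa [MvPolynomial.coe_basisMonomials] at this
  have h1 : L ((∑ i, MvPolynomial.X i) ^ n) = ∑ c : U → Fin k, ∏ i, a (Nat.card (c ⁻¹' {i})) := by
    have : (∑ i, MvPolynomial.X i : MvPolynomial (Fin k) ℝ) ^ n =
        ∑ c : U → Fin k, ∏ u, MvPolynomial.X (c u) := by
      rw [← Fintype.piFinset_univ, ← Finset.prod_univ_sum, Finset.prod_const, Finset.card_univ]
    rw [this, map_sum]
    refine Finset.sum_congr rfl fun c _ => ?_
    have : ∏ u, MvPolynomial.X (R := ℝ) (c u) =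
        MvPolynomial.monomial (∑ u, Finsupp.single (c u) 1) 1 := by
      rw [MvPolynomial.monomial_sum_one]
      rfl
    rw [this, hL]
    refine Finset.prod_congr rfl fun i _ => ?_
    rw [Finsupp.finsetSum_apply, show Nat.card (c ⁻¹' {i}) = Nat.card {u // c u = i} from rfl,
      Nat.card_eq_fintype_card, Fintype.card_subtype]
    simp [Finsupp.single_apply]
  rw [← h1, Finset.sum_pow_eq_sum_piAntidiag, map_sum]
  have h2 : (mk fun n => a n / (n.factorial : ℝ)) ^ k =
      ∏ _i : Fin k, mk fun n => a n / (n.factorial : ℝ) := by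
    simp
  rw [h2, coeff_prod, Finset.mul_sum]
  refine Finset.sum_bij' (fun m _ => Finsupp.equivFunOnFinite.symm m) (fun m _ => ⇑m)
    (fun m hm => ?_) (fun m hm => ?_) (fun m _ => rfl)
    (fun m _ => Finsupp.equivFunOnFinite.symm_apply_apply m) (fun m hm => ?_)
  · simpa using hm
  · simpa using hm
  · have hm' : ∑ i, m i = n := by simpa using hm
    have hX : ∏ i, MvPolynomial.X (R := ℝ) i ^ m i =
        MvPolynomial.monomial (Finsupp.equivFunOnFinite.symm m) 1 := by
      rw [MvPolynomial.monomial_eq, Finsupp.prod_fintype _ _ (by simp)]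
      simp
    rw [hX, ← nsmul_eq_mul, map_nsmul, hL, nsmul_eq_mul, ← hm',
      ← Nat.multinomial_spec Finset.univ m]
    simp only [coeff_mk, Finset.prod_div_distrib, Finsupp.equivFunOnFinite_symm_apply_apply]
    push_cast
    have : ∏ i, ((m i).factorial : ℝ) ≠ 0 :=
      Finset.prod_ne_zero_iff.2 fun i _ => by positivity
    field_simp

/-- The class of a partition that contains a given element. -/
def Setoid.IsPartition.classOf {U : Type*} {p : Set (Set U)} (hp : Setoid.IsPartition p) (x : U) :
    p := ⟨(hp.2 x).choose, (hp.2 x).choose_spec.1.1⟩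

theorem Setoid.IsPartition.classOf_eq_iff {U : Type*} {p : Set (Set U)}
    (hp : Setoid.IsPartition p) {x : U} {Q : p} : hp.classOf x = Q ↔ x ∈ (Q : Set U) := by
  have h := (hp.2 x).choose_spec
  constructor
  · rintro rfl
    exact h.1.2
  · intro hx
    exact Subtype.ext (h.2 Q ⟨Q.2, hx⟩).symm

/-- A partition into `k` classes with a numbering of its classes is a surjection onto `Fin k`. -/
def coloringOfPartition (U : Type*) (k : ℕ)
    (e : Σ p : {p : Set (Set U) // Setoid.IsPartition p}, ((p : Set (Set U)) ≃ Fin k)) :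
    {c : U → Fin k // Function.Surjective c} :=
  ⟨fun x => e.2 (e.1.2.classOf x), fun i => by
    obtain ⟨x, hx⟩ := Setoid.nonempty_of_mem_partition e.1.2 (e.2.symm i).2
    exact ⟨x, by simp only [e.1.2.classOf_eq_iff.2 hx, Equiv.apply_symm_apply]⟩⟩

theorem coloringOfPartition_preimage {U : Type*} {k : ℕ}
    (e : Σ p : {p : Set (Set U) // Setoid.IsPartition p}, ((p : Set (Set U)) ≃ Fin k))
    (i : Fin k) : (coloringOfPartition U k e).1 ⁻¹' {i} = (e.2.symm i : Set U) := by
  ext x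
  rw [← e.1.2.classOf_eq_iff, Equiv.eq_symm_apply]
  rfl

theorem coloringOfPartition_bijective (U : Type*) (k : ℕ) :
    Function.Bijective (coloringOfPartition U k) := by
  constructor
  · rintro ⟨⟨p, hp⟩, e⟩ ⟨⟨p', hp'⟩, e'⟩ h
    have h1 (i : Fin k) : (e.symm i : Set U) = e'.symm i := by
      have := coloringOfPartition_preimage ⟨⟨p, hp⟩, e⟩ i
      rw [h, coloringOfPartition_preimage] at this
      exact this.symm
    obtain rfl : p = p' := by
      ext Q
      constructor
      · intro hQ
        have := h1 (e ⟨Q, hQ⟩)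
        rw [e.symm_apply_apply] at this
        change Q = _ at this
        exact this ▸ (e'.symm _).2
      · intro hQ
        have := h1 (e' ⟨Q, hQ⟩)
        rw [e'.symm_apply_apply] at this
        change _ = Q at this
        exact this ▸ (e.symm _).2
    have h2 : e.symm = e'.symm := Equiv.ext fun i => Subtype.ext (h1 i)
    rw [show e = e' by rw [← e.symm_symm, h2, e'.symm_symm]]
  · rintro ⟨c, hc⟩
    -- The preimage of a surjective colouring is the partition into its fibres, numbered by colour.
    have hp : Setoid.IsPartition (Set.range fun i => c ⁻¹' {i}) := by
      constructor
      · rintro ⟨i, hi⟩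
        obtain ⟨x, hx⟩ := hc i
        exact (hi ▸ hx : x ∈ (∅ : Set U))
      · intro x
        refine ⟨c ⁻¹' {c x}, ⟨⟨c x, rfl⟩, rfl⟩, ?_⟩
        rintro _ ⟨⟨i, rfl⟩, hx⟩
        rw [show c x = i from hx]
    have hinj : Function.Injective fun i => c ⁻¹' {i} := by
      intro i j hij
      obtain ⟨x, rfl⟩ := hc i
      change c ⁻¹' {c x} = c ⁻¹' {j} at hij
      exact (hij ▸ rfl : x ∈ c ⁻¹' {j})
    refine ⟨⟨⟨_, hp⟩, (Equiv.ofInjective _ hinj).symm⟩, Subtype.ext (funext fun x => ?_)⟩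
    change (Equiv.ofInjective _ hinj).symm (hp.classOf x) = c x
    rw [Equiv.symm_apply_eq, hp.classOf_eq_iff]
    rfl

/-- Colourings that miss a colour contribute zero because `a 0 = 0`, and each partition into `k`
classes comes from `k!` surjective colourings. -/
theorem sum_partition_eq_coeff_pow (U : Type*) [Finite U] (k : ℕ) (a : ℕ → ℝ) (ha : a 0 = 0) :
    (k.factorial : ℝ) * ∑ᶠ p : {p : Set (Set U) // Setoid.IsPartition p},
        (if Nat.card p.1 = k then ∏ᶠ Q : p.1, a (Nat.card (Q : Set U)) else 0) =
      ((Nat.card U).factorial : ℝ) *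
        coeff (Nat.card U) ((mk fun n => a n / (n.factorial : ℝ)) ^ k) := by
  classical
  have := Fintype.ofFinite U
  have (p : {p : Set (Set U) // Setoid.IsPartition p}) := Fintype.ofFinite p.1
  rw [Nat.card_eq_fintype_card, ← sum_coloring_eq_coeff_pow]
  have hsurj : ∑ c : U → Fin k, ∏ i, a (Nat.card (c ⁻¹' {i})) =
      ∑ c : {c : U → Fin k // Function.Surjective c}, ∏ i, a (Nat.card (c.1 ⁻¹' {i})) := by
    rw [← Finset.sum_subtype (Finset.univ.filter Function.Surjective) (by simp)
      fun c => ∏ i, a (Nat.card (c ⁻¹' {i}))]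
    refine (Finset.sum_subset (Finset.subset_univ _) fun c _ hc => ?_).symm
    simp only [Finset.mem_filter, Finset.mem_univ, true_and, Function.Surjective, not_forall,
      not_exists] at hc
    obtain ⟨i, hi⟩ := hc
    refine Finset.prod_eq_zero (Finset.mem_univ i) ?_
    rw [Set.preimage_singleton_eq_empty.2 fun ⟨x, hx⟩ => hi x hx]
    simpa using ha
  rw [hsurj, ← (coloringOfPartition_bijective U k).sum_comp, Fintype.sum_sigma,
    finsum_eq_sum_of_fintype, Finset.mul_sum]
  refine Finset.sum_congr rfl fun p _ => ?_
  have hterm (e : p.1 ≃ Fin k) :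
      ∏ i, a (Nat.card ((coloringOfPartition U k ⟨p, e⟩).1 ⁻¹' {i})) =
        ∏ᶠ Q : p.1, a (Nat.card (Q : Set U)) := by
    rw [finprod_eq_prod_of_fintype, ← e.symm.prod_comp]
    exact Finset.prod_congr rfl fun i _ => by rw [coloringOfPartition_preimage]
  simp_rw [hterm]
  rw [Finset.sum_const, nsmul_eq_mul, Finset.card_univ]
  split_ifs with hk
  · rw [Fintype.card_equiv (Finite.equivFinOfCardEq hk), ← Nat.card_eq_fintype_card, hk]
  · have : IsEmpty (p.1 ≃ Fin k) := ⟨fun e => hk (by rw [Nat.card_congr e, Nat.card_fin])⟩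
    simp

end Colorings

/-! ### Total weights, generating series and the composition formula -/

namespace WeightedSpecies

/-- The total weight of the structures on a label set. -/
def total (A : WeightedSpecies.{u}) (U : Type) [Finite U] : ℝ := ∑ᶠ x : A.obj U, (A.weight x : ℝ)

/-- The bijection between structures induced by a bijection of the label sets. -/
def mapEquiv (A : WeightedSpecies.{u}) {U V : Type} [Finite U] [Finite V] (σ : U ≃ V) :
    A.obj U ≃ A.obj V where
  toFun := A.map σ
  invFun := A.map σ.symm
  left_inv x := by rw [← A.map_trans, Equiv.self_trans_symm, A.map_refl]
  right_inv x := by rw [← A.map_trans, Equiv.symm_trans_self, A.map_refl]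

theorem total_congr (A : WeightedSpecies.{u}) {U V : Type} [Finite U] [Finite V] (σ : U ≃ V) :
    A.total U = A.total V := by
  unfold total
  rw [← finsum_comp_equiv (A.mapEquiv σ)]
  exact finsum_congr fun x => by rw [← A.weight_map σ]; rfl

theorem coeff_egf (A : WeightedSpecies.{u}) (n : ℕ) :
    PowerSeries.coeff n A.egf = A.total (Fin n) / (n.factorial : ℝ) := PowerSeries.coeff_mk _ _

theorem total_eq_card (A : WeightedSpecies.{u}) (U : Type) [Finite U] :
    A.total U = A.total (Fin (Nat.card U)) := A.total_congr (Finite.equivFin U)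

theorem total_nonneg (A : WeightedSpecies.{u}) (U : Type) [Finite U] : 0 ≤ A.total U :=
  finsum_nonneg fun _ => NNReal.coe_nonneg _

theorem coeff_egf_nonneg (A : WeightedSpecies.{u}) (n : ℕ) : 0 ≤ PowerSeries.coeff n A.egf := by
  rw [coeff_egf]
  exact div_nonneg (A.total_nonneg _) (Nat.cast_nonneg _)

theorem coeff_zero_egf_of_isEmpty (A : WeightedSpecies.{u}) (h : IsEmpty (A.obj Empty)) :
    PowerSeries.coeff 0 A.egf = 0 := by
  rw [coeff_egf, ← A.total_congr (Equiv.equivOfIsEmpty Empty (Fin 0)), total, finsum_of_isEmpty,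
    zero_div]

/-- The factor `n + 1` is the source of the `k` in the limit weights `f_k k s^(k-1)`. -/
theorem coeff_egf_derived (A : WeightedSpecies.{u}) (n : ℕ) :
    PowerSeries.coeff n A.derived.egf = (n + 1) * PowerSeries.coeff (n + 1) A.egf := by
  have h : A.derived.total (Fin n) = A.total (Fin (n + 1)) := by
    change A.total (Option (Fin n)) = _
    exact A.total_congr (Fintype.equivFinOfCardEq (by simp))
  rw [coeff_egf, coeff_egf, h, Nat.factorial_succ]
  push_cast
  field_simp

/-- A composite structure as a partition with an outer structure and a family of inner ones. -/
def compEquiv (F : WeightedSpecies.{u}) (G : WeightedSpecies.{v}) (U : Type) [Finite U] :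
    CompositeStructure F G U ≃ Σ p : {p : Set (Set U) // Setoid.IsPartition p},
      F.obj p.1 × ((Q : p.1) → G.obj (Q : Set U)) where
  toFun s := ⟨⟨s.parts, s.isPartition⟩, s.outer, s.inner⟩
  invFun t := ⟨t.1.1, t.1.2, t.2.1, t.2.2⟩
  left_inv _ := rfl
  right_inv _ := rfl

/-- For a fixed partition into `k` classes the sum factorises: the outer structures give a total
depending only on `k`, and the inner ones a product of totals depending only on class sizes. The
`k!` from numbering the classes cancels the denominator in `F.egf`. -/
theorem sum_weight_numComponents_eq (F : WeightedSpecies.{u}) (G : WeightedSpecies.{v})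
    (hG : PowerSeries.coeff 0 G.egf = 0) (U : Type) [Finite U] (k : ℕ) :
    (∑ᶠ s : CompositeStructure F G U, if s.numComponents = k then (s.weight : ℝ) else 0) =
      ((Nat.card U).factorial : ℝ) *
        (PowerSeries.coeff k F.egf * PowerSeries.coeff (Nat.card U) (G.egf ^ k)) := by
  classical
  have := Fintype.ofFinite U
  have (p : {p : Set (Set U) // Setoid.IsPartition p}) := Fintype.ofFinite p.1
  have (p : {p : Set (Set U) // Setoid.IsPartition p}) := Fintype.ofFinite (F.obj p.1)
  have (Q : Set U) := Fintype.ofFinite (G.obj Q)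
  have := Fintype.ofFinite (CompositeStructure F G U)
  have hG0 : G.total (Fin 0) = 0 := by simpa [coeff_egf] using hG
  have hGe : G.egf = PowerSeries.mk fun n => G.total (Fin n) / (n.factorial : ℝ) :=
    PowerSeries.ext fun n => by rw [coeff_egf, PowerSeries.coeff_mk]
  have key := sum_partition_eq_coeff_pow U k (fun n => G.total (Fin n)) hG0
  rw [← hGe] at key
  rw [mul_left_comm, ← key, coeff_egf, div_mul_eq_mul_div, mul_div_assoc,
    mul_div_cancel_left₀ _ (by positivity : (k.factorial : ℝ) ≠ 0), finsum_eq_sum_of_fintype,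
    finsum_eq_sum_of_fintype, ← (compEquiv F G U).symm.sum_comp, Fintype.sum_sigma, Finset.mul_sum]
  refine Finset.sum_congr rfl fun p _ => ?_
  have hnum (t : F.obj p.1 × ((Q : p.1) → G.obj (Q : Set U))) :
      ((compEquiv F G U).symm ⟨p, t⟩).numComponents = Nat.card p.1 := rfl
  simp_rw [hnum]
  split_ifs with hk
  · have hw (t : F.obj p.1 × ((Q : p.1) → G.obj (Q : Set U))) :
        (((compEquiv F G U).symm ⟨p, t⟩).weight : ℝ) =
          F.weight t.1 * ∏ Q : p.1, (G.weight (t.2 Q) : ℝ) := by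
      change ((F.weight t.1 * ∏ᶠ Q : p.1, G.weight (t.2 Q) : ℝ≥0) : ℝ) = _
      rw [finprod_eq_prod_of_fintype]
      push_cast
      rfl
    simp_rw [hw]
    rw [Fintype.sum_prod_type]
    simp_rw [← Finset.mul_sum, ← Finset.sum_mul]
    have h1 : ∑ x : F.obj p.1, (F.weight x : ℝ) = F.total (Fin k) := by
      rw [← hk, ← F.total_eq_card, total, finsum_eq_sum_of_fintype]
    have h2 : ∑ y : (Q : p.1) → G.obj (Q : Set U), ∏ Q : p.1, (G.weight (y Q) : ℝ) =
        ∏ᶠ Q : p.1, G.total (Fin (Nat.card (Q : Set U))) := by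
      rw [finprod_eq_prod_of_fintype, ← Fintype.piFinset_univ,
        ← Finset.prod_univ_sum (f := fun Q y => (G.weight y : ℝ))]
      exact Finset.prod_congr rfl fun Q _ => by
        rw [← G.total_eq_card, total, finsum_eq_sum_of_fintype]
    rw [h1, h2]
  · simp

end WeightedSpecies

/-! ## The number of components of random composite structures -/

theorem tsum_ite_coe_eq_ofReal_finsum {α : Type*} [Finite α] (w : α → ℝ≥0) (p : α → Prop)
    [DecidablePred p] : (∑' a, if p a then (w a : ℝ≥0∞) else 0) =
      ENNReal.ofReal (∑ᶠ a, if p a then (w a : ℝ) else 0) := by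
  have := Fintype.ofFinite α
  rw [tsum_fintype, finsum_eq_sum_of_fintype, ENNReal.ofReal_sum_of_nonneg]
  · refine Finset.sum_congr rfl fun a _ => ?_
    split_ifs <;> simp
  · intro a _
    split_ifs <;> simp

/-- A power series with non-negative coefficients has finite moments strictly inside its disc of
convergence. -/
theorem summable_coeff_mul_pow_mul_pow {f : PowerSeries ℝ} {r : ℝ≥0} (hr : (r : ℝ≥0∞) < seriesRadius f)
    {t : ℝ} (ht0 : 0 ≤ t) (ht : t < r) (m : ℕ) :
    Summable fun k : ℕ => PowerSeries.coeff k f * t ^ k * (k : ℝ) ^ m := by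
  obtain ⟨C, hC, hle⟩ := FormalMultilinearSeries.norm_mul_pow_le_of_lt_radius _ hr
  have hr0 : (0 : ℝ) < r := ht0.trans_lt ht
  have hgeo : Summable fun k : ℕ => C * ((k : ℝ) ^ m * (t / r) ^ k) := by
    refine (summable_pow_mul_geometric_of_norm_lt_one m ?_).mul_left C
    rw [Real.norm_of_nonneg (by positivity)]
    exact (div_lt_one hr0).2 ht
  refine .of_norm_bounded hgeo fun k => ?_
  have h1 := hle k
  rw [FormalMultilinearSeries.ofScalars_norm] at h1
  rw [norm_mul, norm_mul, norm_pow, norm_pow, Real.norm_of_nonneg ht0, Real.norm_natCast, div_pow]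
  calc _ = ‖PowerSeries.coeff k f‖ * (r : ℝ) ^ k * ((k : ℝ) ^ m * (t ^ k / (r : ℝ) ^ k)) := by
        field_simp
    _ ≤ _ := by gcongr

namespace WeightedSpecies

variable {F : WeightedSpecies.{u}} {G : WeightedSpecies.{v}}

theorem map_components_sizedLaw (hG : PowerSeries.coeff 0 G.egf = 0) {n : ℕ}
    (hn : 0 < PowerSeries.coeff n G.egf) :
    ((F.comp G).sizedLaw n).map (fun s => components s) =
      natLaw fun k => PowerSeries.coeff k F.egf *
        (PowerSeries.coeff n (G.egf ^ k) / PowerSeries.coeff n G.egf) := by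
  have hr : 0 < (n.factorial : ℝ) * PowerSeries.coeff n G.egf := by positivity
  rw [sizedLaw, map_proportionalLaw _ measurable_from_top, natLaw,
    ← proportionalLaw_const_mul (fun k => ENNReal.ofReal (PowerSeries.coeff k F.egf *
        (PowerSeries.coeff n (G.egf ^ k) / PowerSeries.coeff n G.egf)))
      (ENNReal.ofReal_pos.2 hr).ne' ENNReal.ofReal_ne_top]
  congr 1
  funext k
  rw [← ENNReal.ofReal_mul hr.le, tsum_ite_coe_eq_ofReal_finsum]
  congr 1
  refine (sum_weight_numComponents_eq F G hG (Fin n) k).trans ?_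
  rw [Nat.card_fin]
  field_simp

theorem map_components_boltzmannLaw {d : ℕ} {ρ : ℝ} (hG : PowerSeries.coeff 0 G.egf = 0)
    (hGd : IsSubexponential d G.egf ρ) :
    ((F.derived.comp G).boltzmannLaw ρ).map (fun r => 1 + components r.2) =
      natLaw fun k => PowerSeries.coeff k F.egf * (k * seriesValue G.egf ρ ^ (k - 1)) := by
  have hρ := hGd.radius_pos
  rw [boltzmannLaw, map_proportionalLaw _ measurable_from_top, natLaw]
  congr 1
  funext k
  rcases k with _ | k
  -- Both weights vanish at `0`: `1 + c` is never `0`, and the right side carries the factor `k`.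
  · simp
  have hinner (n : ℕ) : (∑' s : (F.derived.comp G).obj (Fin n), if 1 + components s = k + 1 then
        ENNReal.ofReal (((F.derived.comp G).weight s : ℝ) * ρ ^ n / (n.factorial : ℝ)) else 0) =
      ENNReal.ofReal (PowerSeries.coeff k F.derived.egf *
        (PowerSeries.coeff n (G.egf ^ k) * ρ ^ n)) := by
    have h1 (s : (F.derived.comp G).obj (Fin n)) : (if 1 + components s = k + 1 then
        ENNReal.ofReal (((F.derived.comp G).weight s : ℝ) * ρ ^ n / (n.factorial : ℝ)) else 0) =
        ENNReal.ofReal (ρ ^ n / n.factorial) *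
          (if components s = k then ((F.derived.comp G).weight s : ℝ≥0∞) else 0) := by
      rw [mul_ite, mul_zero, mul_div_assoc, ENNReal.ofReal_mul (NNReal.coe_nonneg _),
        ENNReal.ofReal_coe_nnreal, mul_comm]
      exact if_congr (by omega) rfl rfl
    simp_rw [h1]
    rw [ENNReal.tsum_mul_left, tsum_ite_coe_eq_ofReal_finsum,
      ← ENNReal.ofReal_mul (by positivity)]
    congr 1
    have h2 := sum_weight_numComponents_eq F.derived G hG (Fin n) k
    rw [Nat.card_fin] at h2
    refine (congrArg _ h2).trans ?_
    field_simp
  have hsum := hGd.hasSum_coeff_pow k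
  refine (ENNReal.tsum_sigma' _).trans ((tsum_congr hinner).trans ?_)
  rw [← ENNReal.ofReal_tsum_of_nonneg, tsum_mul_left, hsum.tsum_eq, coeff_egf_derived]
  · congr 1
    push_cast
    ring
  · intro n
    exact mul_nonneg (coeff_egf_nonneg _ _) (mul_nonneg
      (PowerSeries.coeff_pow_nonneg hGd.coeff_nonneg _ _) (by positivity))
  · exact hsum.summable.mul_left _

end WeightedSpecies

end

/-! ### The limit theorem -/

theorem proposition3p2 (F : WeightedSpecies.{u}) (G : WeightedSpecies.{v})
    (hG : IsEmpty (G.obj Empty))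
    (hF : ∃ k : ℕ, 1 ≤ k ∧ 0 < PowerSeries.coeff k F.egf)
    (d : ℕ) (ρ : ℝ) (hGd : IsSubexponential d G.egf ρ)
    (hrad : ENNReal.ofReal (seriesValue G.egf ρ) < seriesRadius F.egf) :
    -- the random structures exist
    (∀ᶠ n in atTop ⊓ 𝓟 {n : ℕ | d ∣ n}, IsProbabilityMeasure ((F.comp G).sizedLaw n)) ∧
    IsProbabilityMeasure ((F.derived.comp G).boltzmannLaw ρ) ∧
    -- convergence in total variation
    Tendsto (fun n : ℕ => tvDist
        (((F.comp G).sizedLaw n).map fun s => WeightedSpecies.components s)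
        (((F.derived.comp G).boltzmannLaw ρ).map fun r => 1 + WeightedSpecies.components r.2))
      (atTop ⊓ 𝓟 {n : ℕ | d ∣ n}) (𝓝 0) ∧
    -- convergence of all moments
    ∀ k : ℕ,
      Integrable (fun r => (1 + (WeightedSpecies.components r.2 : ℝ)) ^ k)
        ((F.derived.comp G).boltzmannLaw ρ) ∧
      Tendsto (fun n : ℕ =>
          ∫ s, (WeightedSpecies.components s : ℝ) ^ k ∂((F.comp G).sizedLaw n))
        (atTop ⊓ 𝓟 {n : ℕ | d ∣ n})
        (𝓝 (∫ r, (1 + (WeightedSpecies.components r.2 : ℝ)) ^ k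
          ∂((F.derived.comp G).boltzmannLaw ρ))) := by
  have hG0 := G.coeff_zero_egf_of_isEmpty hG
  set l : Filter ℕ := atTop ⊓ 𝓟 {n : ℕ | d ∣ n} with hl
  have : l.NeBot := by
    rw [hl, atTop_inf_principal_dvd hGd.one_le_span]
    infer_instance
  set s := seriesValue G.egf ρ with hs
  have hs0 : 0 < s := hGd.seriesValue_pos
  obtain ⟨r, hsr, hr⟩ := ENNReal.lt_iff_exists_nnreal_btwn.1 hrad
  replace hsr : s < r := by
    rwa [← ENNReal.ofReal_coe_nnreal, ENNReal.ofReal_lt_ofReal_iff_of_nonneg hs0.le] at hsr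
  -- Taking `ε = (r - s) / 2` puts `t = s + ε` strictly below `r`, which itself lies inside the disc
  -- of convergence of `F.egf`.
  obtain ⟨B, hB, hle⟩ := hGd.exists_coeff_pow_le (half_pos (sub_pos.2 hsr))
  rw [← hs] at hle
  set t := s + (r - s) / 2 with ht
  have ht0 : 0 ≤ t := by linarith
  have htr : t < r := by linarith
  have hf := F.coeff_egf_nonneg
  have hpos := hGd.eventually_coeff_pos
  have hlim (k : ℕ) : Tendsto (fun n => PowerSeries.coeff k F.egf *
      (PowerSeries.coeff n (G.egf ^ k) / PowerSeries.coeff n G.egf)) l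
      (𝓝 (PowerSeries.coeff k F.egf * (k * s ^ (k - 1)))) :=
    (hGd.tendsto_coeff_pow k).const_mul _
  have hdom : ∀ᶠ n in l, ∀ k, PowerSeries.coeff k F.egf *
      (PowerSeries.coeff n (G.egf ^ k) / PowerSeries.coeff n G.egf) ≤
        PowerSeries.coeff k F.egf * (B * t ^ k) :=
    hle.mono fun n hn k => mul_le_mul_of_nonneg_left (hn k) (hf k)
  -- The limit weights inherit the domination; this needs `l` to be a nontrivial filter.
  have hlimdom (k : ℕ) : PowerSeries.coeff k F.egf * (k * s ^ (k - 1)) ≤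
      PowerSeries.coeff k F.egf * (B * t ^ k) :=
    le_of_tendsto (hlim k) (hdom.mono fun n hn => hn k)
  have hmom (m : ℕ) :
      Summable fun k : ℕ => PowerSeries.coeff k F.egf * (B * t ^ k) * (k : ℝ) ^ m :=
    ((summable_coeff_mul_pow_mul_pow hr ht0 htr m).mul_left B).congr fun k => by ring
  have hb (k : ℕ) : 0 ≤ PowerSeries.coeff k F.egf * (k * s ^ (k - 1)) :=
    mul_nonneg (hf k) (by positivity)
  have htotal : 0 < ∑' k : ℕ, PowerSeries.coeff k F.egf * (k * s ^ (k - 1)) := by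
    obtain ⟨k, hk1, hk⟩ := hF
    have hk0 : (0 : ℝ) < k := by exact_mod_cast hk1
    refine Summable.tsum_pos (.of_nonneg_of_le hb hlimdom (by simpa using hmom 0)) hb k ?_
    positivity
  have hA : ∀ᶠ n in l, ∀ k, 0 ≤ PowerSeries.coeff k F.egf *
      (PowerSeries.coeff n (G.egf ^ k) / PowerSeries.coeff n G.egf) :=
    .of_forall fun n k => mul_nonneg (hf k) (div_nonneg
      (PowerSeries.coeff_pow_nonneg hGd.coeff_nonneg _ _) (hGd.coeff_nonneg n))
  obtain ⟨hprobA, hprob, htv, hmoments⟩ := natLaw_tendsto hA hb hlim hdom hlimdom hmom htotal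
  have hmapA : ∀ᶠ n in l, ((F.comp G).sizedLaw n).map (fun s => WeightedSpecies.components s) =
      natLaw fun k => PowerSeries.coeff k F.egf *
        (PowerSeries.coeff n (G.egf ^ k) / PowerSeries.coeff n G.egf) :=
    hpos.mono fun n hn => WeightedSpecies.map_components_sizedLaw hG0 hn
  have hmap := WeightedSpecies.map_components_boltzmannLaw (F := F) hG0 hGd
  have hmeas : Measurable fun r : (F.derived.comp G).Universe =>
      1 + WeightedSpecies.components r.2 := measurable_from_top
  have hcast (k : ℕ) : (fun r : (F.derived.comp G).Universe =>
      (1 + (WeightedSpecies.components r.2 : ℝ)) ^ k) =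
      (fun j : ℕ => (j : ℝ) ^ k) ∘ fun r => 1 + WeightedSpecies.components r.2 := by
    funext r
    simp
  refine ⟨?_, ?_, ?_, fun k => ⟨?_, ?_⟩⟩
  · filter_upwards [hprobA, hmapA] with n h1 h2
    rw [← h2] at h1
    -- A pushforward has the same total mass, so the law of the structure is a probability measure
    -- because that of its component count is.
    exact Measure.isProbabilityMeasure_of_map fun s => WeightedSpecies.components s
  · rw [← hmap] at hprob
    exact Measure.isProbabilityMeasure_of_map fun r => 1 + WeightedSpecies.components r.2
  · rw [hmap]
    exact htv.congr' (hmapA.mono fun n hn => by beta_reduce; rw [hn])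
  · rw [hcast, ← integrable_map_measure (by fun_prop) hmeas.aemeasurable, hmap]
    exact (hmoments k).1
  · have h1 := (hmoments k).2
    rw [← hmap, integral_map hmeas.aemeasurable (by fun_prop)] at h1
    have h2 : ∫ r, (1 + (WeightedSpecies.components r.2 : ℝ)) ^ k
          ∂((F.derived.comp G).boltzmannLaw ρ) =
        ∫ r, ((1 + WeightedSpecies.components r.2 : ℕ) : ℝ) ^ k
          ∂((F.derived.comp G).boltzmannLaw ρ) := by
      simp
    rw [h2]
    refine h1.congr' (hmapA.mono fun n hn => ?_)
    rw [← hn, integral_map measurable_from_top.aemeasurable (by fun_prop)]
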